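/- Let $x_1,\dots,x_n\in\mathbb R^d$ and $y\in\mathbb R^n$ be training data. For $W=(w_1,\dots,w_m)\in(\mathbb R^d)^m$ and $a\in\mathbb R^m$ let $$f(W,a,x)=\frac1{\sqrt m}\sum_{r=1}^m a_r\,\sigma(w_r^\top x),\qquad \sigma(z)=\max(z,0).$$ A gradient flow on the first layer (for the loss $\frac12\sum_{i=1}^n(f(W,a,x_i)-y_i)^2$, with $a$ fixed) is a curve $W:[0,\infty)\to(\mathbb R^d)^m$, absolutely continuous on every interval $[0,T]$, such that for almost every $t>0$ there are numbers $\xi_{ir}\in\partial\sigma(w_r(t)^\top x_i)$ with $$\frac{d w_r(t)}{dt}=-\frac1{\sqrt m}\sum_{i=1}^n\bigl(f(W(t),a,x_i)-y_i\bigr)\,a_r\,\xi_{ir}\,x_i\qquad(1\le r\le m);$$ here $\partial\sigma(z)$ is $\{1\}$ for $z>0$, $\{0\}$ for $z<0$ and $[0,1]$ for $z=0$ (so $\xi_{ir}=\mathbb I\{w_r(t)^\top x_i\ge0\}$ is allowed). Write $u(t)=(f(W(t),a,x_i))_{i=1}^n\in\mathbb R^n$. Let $\mathbf H^\infty\in\mathbb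 R^{n\times n}$ be the matrix with entries $$\mathbf H^\infty_{ij}=\mathbb E_{w\sim N(0,I)}\left[x_i^\top x_j\,\mathbb I\{w^\top x_i\ge0,\ w^\top x_j\ge0\}\right],$$ and $\lambda_0=\lambda_{\min}(\mathbf H^\infty)$ its least eigenvalue. **Theorem (Convergence Rate of Gradient Flow).** For every $C$ there is a constant $K>0$, depending only on $C$, such that the following holds for all $n\ge1$, $d$, $m$, all data $(x_i,y_i)_{i=1}^n$ and all $\delta>0$. Suppose that $\lambda_0>0$, that $\|x_i\|_2=1$ and $|y_i|\le C$ for all $i$, and that $$m\ge K\,\frac{n^6}{\lambda_0^4\,\delta^3}.$$ Let $w_1(0),\dots,w_m(0)\sim N(0,I)$ and $a_1,\dots,a_m\sim\mathrm{unif}\{-1,1\}$ all be independent. Then with probability at least $1-\delta$ over this initialization, every gradient flow $W$ on the first layer that starts at $W(0)=(w_1(0),\dots,w_m(0))$ satisfies, for all $t\ge0$, $$\|u(t)-y\|_2^2\le\exp(-\lambda_0t)\,\|u(0)-y\|_2^2 .$$ -/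

import Mathlib

open MeasureTheory ProbabilityTheory Set

namespace TwoLayerReLU

noncomputable section

/-- The ReLU activation `z ↦ max z 0`. -/
def relu (z : ℝ) : ℝ := max z 0

/-- The (convex) subdifferential of ReLU at `z`: it is `{1}` for `z > 0`, `{0}` for `z < 0`, and
`[0, 1]` for `z = 0`. -/
def reluSubdifferential (z : ℝ) : Set ℝ :=
  {s | 0 ≤ s ∧ s ≤ 1 ∧ (0 < z → s = 1) ∧ (z < 0 → s = 0)}

/-- The network `f(W, a, v) = (1 / √m) ∑ r, a r * relu ⟨W r, v⟩`. -/
def network {d m : ℕ} (W : Fin m → EuclideanSpace ℝ (Fin d)) (a : Fin m → ℝ)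
    (v : EuclideanSpace ℝ (Fin d)) : ℝ :=
  (1 / Real.sqrt m) * ∑ r, a r * relu (inner ℝ (W r) v)

/-- The vector `(f(W, a, x 1), …, f(W, a, x n))` of predictions on the training inputs. -/
def prediction {n d m : ℕ} (x : Fin n → EuclideanSpace ℝ (Fin d)) (a : Fin m → ℝ)
    (W : Fin m → EuclideanSpace ℝ (Fin d)) : EuclideanSpace ℝ (Fin n) :=
  WithLp.toLp 2 fun i => network W a (x i)

/-- The gradient formula with respect to the first layer of the loss
`(1 / 2) ∑ i, (f(W, a, x i) - y i) ^ 2`, in which the derivative of ReLU at `⟨W r, x i⟩` is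
replaced by the number `ξ i r`; its `r`-th entry is
`(1 / √m) ∑ i, (f(W, a, x i) - y i) a r (ξ i r) (x i)`. -/
def gradientFormula {n d m : ℕ} (x : Fin n → EuclideanSpace ℝ (Fin d))
    (y : EuclideanSpace ℝ (Fin n)) (a : Fin m → ℝ) (W : Fin m → EuclideanSpace ℝ (Fin d))
    (ξ : Fin n → Fin m → ℝ) (r : Fin m) : EuclideanSpace ℝ (Fin d) :=
  (1 / Real.sqrt m) • ∑ i, ((network W a (x i) - y i) * a r * ξ i r) • x i

/-- The set-valued gradient of the loss with respect to the first layer: all values of the gradient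
formula with `ξ i r` in the subdifferential of ReLU at `⟨W r, x i⟩`. It is a singleton, the usual
gradient, unless some `⟨W r, x i⟩` vanishes. -/
def lossSubgradient {n d m : ℕ} (x : Fin n → EuclideanSpace ℝ (Fin d))
    (y : EuclideanSpace ℝ (Fin n)) (a : Fin m → ℝ) (W : Fin m → EuclideanSpace ℝ (Fin d)) :
    Set (Fin m → EuclideanSpace ℝ (Fin d)) :=
  {G | ∃ ξ : Fin n → Fin m → ℝ,
    (∀ i r, ξ i r ∈ reluSubdifferential (inner ℝ (W r) (x i))) ∧ G = gradientFormula x y a W ξ}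

/-- The gradient formula with the indicators `𝟙 {⟨W r, x i⟩ ≥ 0}` is one of the subgradients, so
that the differential inclusion below covers the differential equation written with them. -/
theorem indicator_mem_lossSubgradient {n d m : ℕ} (x : Fin n → EuclideanSpace ℝ (Fin d))
    (y : EuclideanSpace ℝ (Fin n)) (a : Fin m → ℝ) (W : Fin m → EuclideanSpace ℝ (Fin d)) :
    gradientFormula x y a W
        (fun i r => (Ici (0 : ℝ)).indicator (fun _ => (1 : ℝ)) (inner ℝ (W r) (x i))) ∈
      lossSubgradient x y a W := by
  refine ⟨_, fun i r => ?_, rfl⟩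
  by_cases h : 0 ≤ (inner ℝ (W r) (x i) : ℝ)
  · simp [reluSubdifferential, h, not_lt.mpr h]
  · simp [reluSubdifferential, h, le_of_not_ge h]

/-- `W` is a gradient flow of the loss in the first layer, on the time interval `[0, ∞)`, with the
second layer `a` fixed: each weight vector is absolutely continuous on every `[0, T]`, and
`dW/dt ∈ -∂L(W)` for almost every `t > 0`. -/
structure IsGradientFlow {n d m : ℕ} (x : Fin n → EuclideanSpace ℝ (Fin d))
    (y : EuclideanSpace ℝ (Fin n)) (a : Fin m → ℝ)
    (W : ℝ → Fin m → EuclideanSpace ℝ (Fin d)) : Prop where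
  absolutelyContinuous : ∀ r, ∀ T : ℝ, 0 ≤ T →
    AbsolutelyContinuousOnInterval (fun t => W t r) 0 T
  inclusion : ∀ᵐ t ∂(volume.restrict (Ioi (0 : ℝ))),
    ∃ G ∈ lossSubgradient x y a (W t), ∀ r, HasDerivAt (fun s => W s r) (-G r) t

/-- The Gram matrix `H^∞`, with entries
`𝔼_{w ∼ N(0, I)} [⟨x i, x j⟩ 𝟙 {⟨w, x i⟩ ≥ 0, ⟨w, x j⟩ ≥ 0}]`. -/
def gramInfinity {n d : ℕ} (x : Fin n → EuclideanSpace ℝ (Fin d)) : Matrix (Fin n) (Fin n) ℝ :=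
  Matrix.of fun i j => ∫ w, {w : EuclideanSpace ℝ (Fin d) |
      0 ≤ (inner ℝ w (x i) : ℝ) ∧ 0 ≤ (inner ℝ w (x j) : ℝ)}.indicator
    (fun _ => (inner ℝ (x i) (x j) : ℝ)) w ∂(stdGaussian (EuclideanSpace ℝ (Fin d)))

/-- The least eigenvalue of a real symmetric matrix of positive size (and `0` for the empty
matrix). -/
def leastEigenvalue {n : ℕ} (A : Matrix (Fin n) (Fin n) ℝ) : ℝ := sInf (spectrum ℝ A)

/-- The law of the random initialization `(W(0), a)`: all the weight vectors and output weights are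
independent, the weight vectors with law `N(0, I)`, the output weights uniform on `{-1, 1}`. -/
def initLaw (d m : ℕ) : Measure ((Fin m → EuclideanSpace ℝ (Fin d)) × (Fin m → ℝ)) :=
  (Measure.pi fun _ : Fin m => stdGaussian (EuclideanSpace ℝ (Fin d))).prod
    (Measure.pi fun _ : Fin m => uniformOn ({-1, 1} : Set ℝ))

end

end TwoLayerReLU

/-!
Along a gradient flow the squared loss `‖u - y‖ ^ 2` has derivative `-2 (u - y)ᵀ G (u - y)`, where
`G` is the Gram matrix of the current activation pattern. While every neuron stays within a distance
`R` of its initial weight, only the neurons which start in a strip of width `R` around the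
activation boundary of an input can change their activation on it. Hence `G` differs from `H^∞` by
the sampling error at initialization plus the proportion of such neurons, both of which are small
with high probability, the second by Gaussian anti-concentration when `R` is of order `λ₀ δ / n²`.
So `G` is bounded below by `λ₀ / 2` and the loss decays like `exp (-λ₀ t)`. The speed of each neuron
is at most `√(n / m) ‖u - y‖`, so this decay bounds its displacement by
`2 √(n / m) ‖u(0) - y‖ / λ₀`. Because the output weights are random signs, `‖u(0) - y‖ ^ 2` is of
order `n / δ` with high probability, and the displacement is less than `R` when `m` is large. The
weights therefore never reach the distance `R`, and the decay holds for all time.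
-/

namespace TwoLayerReLU

open Filter Topology
open scoped RealInnerProductSpace Matrix

section AbsolutelyContinuous

variable {a b : ℝ}

theorem absolutelyContinuousOnInterval_lipschitzWith_comp {X Y : Type*} [PseudoMetricSpace X]
    [PseudoMetricSpace Y] {f : ℝ → X} {g : X → Y} {K : NNReal} (hg : LipschitzWith K g)
    (hf : AbsolutelyContinuousOnInterval f a b) :
    AbsolutelyContinuousOnInterval (fun t => g (f t)) a b := by
  refine squeeze_zero (fun _ => Finset.sum_nonneg fun _ _ => dist_nonneg) (fun _ => ?_)
    (by simpa using Tendsto.const_mul (K : ℝ) hf)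
  rw [Finset.mul_sum]
  exact Finset.sum_le_sum fun _ _ => hg.dist_le_mul _ _

theorem absolutelyContinuousOnInterval_sum {ι F : Type*} [SeminormedAddCommGroup F]
    {f : ι → ℝ → F} {s : Finset ι} (hf : ∀ i ∈ s, AbsolutelyContinuousOnInterval (f i) a b) :
    AbsolutelyContinuousOnInterval (fun t => ∑ i ∈ s, f i t) a b := by
  classical
  induction s using Finset.induction_on with
  | empty =>
    simpa using (LipschitzWith.const (0 : F)).lipschitzOnWith.absolutelyContinuousOnInterval
  | insert i s hi ih =>
    simp only [Finset.sum_insert hi]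
    exact (hf i (Finset.mem_insert_self i s)).fun_add
      (ih fun j hj => hf j (Finset.mem_insert_of_mem hj))

theorem le_of_ae_deriv_nonpos {f : ℝ → ℝ} (hab : a ≤ b) (hf : AbsolutelyContinuousOnInterval f a b)
    (hf' : ∀ᵐ t, t ∈ Ioo a b → deriv f t ≤ 0) : f b ≤ f a := by
  rw [← sub_nonpos, ← hf.integral_deriv_eq_sub, intervalIntegral.integral_of_le hab,
    integral_Ioc_eq_integral_Ioo]
  exact integral_nonpos_of_ae ((ae_restrict_iff' measurableSet_Ioo).2 hf')

theorem le_exp_mul_of_ae_deriv_le {f : ℝ → ℝ} {c : ℝ} (hab : a ≤ b)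
    (hf : AbsolutelyContinuousOnInterval f a b)
    (hf' : ∀ᵐ t, t ∈ Ioo a b → deriv f t ≤ c * f t) : f b ≤ Real.exp (c * (b - a)) * f a := by
  have hexp : AbsolutelyContinuousOnInterval (fun t => Real.exp (-(c * (t - a)))) a b :=
    ContDiffOn.absolutelyContinuousOnInterval (by fun_prop)
  have hmono := le_of_ae_deriv_nonpos hab (hexp.fun_mul hf) (by
    filter_upwards [hf', hf.ae_differentiableAt] with t ht hd htm
    have hexp' : HasDerivAt (fun t => Real.exp (-(c * (t - a))))
        (Real.exp (-(c * (t - a))) * -(c * 1)) t :=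
      (((hasDerivAt_id t).sub_const a).const_mul c).neg.exp
    have hft := (hd (Icc_subset_uIcc (Ioo_subset_Icc_self htm))).hasDerivAt
    rw [(hexp'.fun_mul hft).deriv]
    linear_combination Real.exp (-(c * (t - a))) * ht htm)
  rw [sub_self, mul_zero, neg_zero, Real.exp_zero, one_mul, Real.exp_neg, inv_mul_le_iff₀
    (Real.exp_pos _)] at hmono
  exact hmono

theorem norm_sub_le_of_ae_norm_deriv_le {E : Type*} [NormedAddCommGroup E] [NormedSpace ℝ E]
    {f : ℝ → E} {F : ℝ → ℝ} (hab : a ≤ b) (hf : AbsolutelyContinuousOnInterval f a b)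
    (hF : AbsolutelyContinuousOnInterval F a b)
    (hf' : ∀ᵐ t, t ∈ Ioo a b → DifferentiableAt ℝ f t ∧ ‖deriv f t‖ ≤ deriv F t) :
    ‖f b - f a‖ ≤ F b - F a := by
  obtain ⟨φ, hφ, hφ_norm⟩ := exists_dual_vector'' ℝ (f b - f a)
  have hmono := le_of_ae_deriv_nonpos hab
    ((absolutelyContinuousOnInterval_lipschitzWith_comp φ.lipschitz hf).fun_sub hF) (by
      filter_upwards [hf', hF.ae_differentiableAt] with t ht hd htm
      obtain ⟨hft, hle⟩ := ht htm
      have hFt := (hd (Icc_subset_uIcc (Ioo_subset_Icc_self htm))).hasDerivAt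
      have hφf : HasDerivAt (fun s => φ (f s)) (φ (deriv f t)) t :=
        φ.hasFDerivAt.comp_hasDerivAt t hft.hasDerivAt
      rw [(hφf.fun_sub hFt).deriv, sub_nonpos]
      exact (le_abs_self _).trans ((φ.le_of_opNorm_le hφ _).trans (by rwa [one_mul])))
  rw [map_sub] at hφ_norm
  simp only [RCLike.ofReal_real_eq_id, id_eq] at hφ_norm
  linarith

end AbsolutelyContinuous

theorem lt_of_forall_Ico_lt {α β : Type*} [ConditionallyCompleteLinearOrder α] [TopologicalSpace α]
    [OrderTopology α] [LinearOrder β] [TopologicalSpace β] [OrderClosedTopology β] {f : α → β}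
    {a b t : α} {R : β} (hf : ContinuousOn f (Icc a b))
    (hstep : ∀ s ∈ Icc a b, (∀ u ∈ Ico a s, f u < R) → f s < R) (ht : t ∈ Icc a b) : f t < R := by
  by_contra! hRt
  have hcompact : IsCompact (Icc a b ∩ f ⁻¹' Ici R) :=
    isCompact_Icc.of_isClosed_subset (hf.preimage_isClosed_of_isClosed isClosed_Icc isClosed_Ici)
      inter_subset_left
  obtain ⟨s, ⟨hs, hRs⟩, hleast⟩ := hcompact.exists_isLeast ⟨t, ht, hRt⟩
  refine (hstep s hs fun u hu => ?_).not_ge hRs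
  by_contra! hRu
  exact hu.2.not_ge (hleast ⟨⟨hu.1, hu.2.le.trans hs.2⟩, hRu⟩)

section ReLU

theorem lipschitzWith_relu : LipschitzWith 1 relu :=
  LipschitzWith.id.max_const 0

theorem lipschitzWith_relu_inner {E : Type*} [NormedAddCommGroup E] [InnerProductSpace ℝ E]
    (v : E) : LipschitzWith ‖v‖₊ fun w : E => relu ⟪w, v⟫ := by
  have hinner : LipschitzWith ‖v‖₊ fun w : E => ⟪w, v⟫ := by
    have hnorm : ‖innerSL ℝ v‖₊ = ‖v‖₊ := NNReal.eq (innerSL_apply_norm ℝ v)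
    simp only [real_inner_comm v]
    exact hnorm ▸ (innerSL ℝ v).lipschitz
  simpa only [one_mul] using! lipschitzWith_relu.comp hinner

theorem relu_sq_le (z : ℝ) : relu z ^ 2 ≤ z ^ 2 :=
  sq_le_sq.2 (by simpa [relu] using abs_max_sub_max_le_abs z 0 0)

theorem abs_le_one_of_mem_reluSubdifferential {z s : ℝ} (hs : s ∈ reluSubdifferential z) :
    |s| ≤ 1 :=
  abs_le.2 ⟨by linarith [hs.1], hs.2.1⟩

theorem hasDerivAt_relu_comp {z : ℝ → ℝ} {z' t s : ℝ} (hz : HasDerivAt z z' t)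
    (hrelu : DifferentiableAt ℝ (fun τ => relu (z τ)) t) (hs : s ∈ reluSubdifferential (z t)) :
    HasDerivAt (fun τ => relu (z τ)) (s * z') t := by
  obtain ⟨-, -, hpos, hneg⟩ := hs
  rcases lt_trichotomy (z t) 0 with h | h | h
  · rw [hneg h, zero_mul]
    refine (hasDerivAt_const t (0 : ℝ)).congr_of_eventuallyEq ?_
    filter_upwards [hz.continuousAt.eventually (gt_mem_nhds h)] with τ hτ
    exact max_eq_right hτ.le
  · -- At a zero of `z`, both `relu ∘ z` and `relu ∘ z - z` are minimal, so `z' = 0`.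
    have hmin : IsLocalMin (fun τ => relu (z τ)) t :=
      Eventually.of_forall fun τ => by simp [relu, h]
    have hmin_sub : IsLocalMin (fun τ => relu (z τ) - z τ) t :=
      Eventually.of_forall fun τ => by simp [relu, h]
    have hderiv := hmin.hasDerivAt_eq_zero hrelu.hasDerivAt
    have hderiv_sub := hmin_sub.hasDerivAt_eq_zero (hrelu.hasDerivAt.sub hz)
    have hz' : z' = 0 := by linarith
    rw [hz', mul_zero, ← hderiv]
    exact hrelu.hasDerivAt
  · rw [hpos h, one_mul]
    refine hz.congr_of_eventuallyEq ?_
    filter_upwards [hz.continuousAt.eventually (lt_mem_nhds h)] with τ hτ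
    exact max_eq_left hτ.le

theorem abs_sub_le_indicator_of_mem_reluSubdifferential {z z₀ s s₀ ρ : ℝ}
    (hs : s ∈ reluSubdifferential z) (hs₀ : s₀ ∈ reluSubdifferential z₀) (h : |z - z₀| ≤ ρ) :
    |s - s₀| ≤ {u : ℝ | |u| ≤ ρ}.indicator (fun _ => 1) z₀ := by
  by_cases hz₀ : |z₀| ≤ ρ
  · rw [indicator_of_mem (s := {u : ℝ | |u| ≤ ρ}) hz₀]
    exact abs_sub_le_of_nonneg_of_le hs.1 hs.2.1 hs₀.1 hs₀.2.1
  · rw [indicator_of_notMem (s := {u : ℝ | |u| ≤ ρ}) hz₀]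
    rw [abs_le] at h
    rcases lt_abs.1 (not_le.1 hz₀) with hρ | hρ
    · rw [hs.2.2.1 (by linarith), hs₀.2.2.1 (by linarith [abs_nonneg (z - z₀)]), sub_self, abs_zero]
    · rw [hs.2.2.2 (by linarith), hs₀.2.2.2 (by linarith), sub_self, abs_zero]

end ReLU

section QuadraticForm

variable {n : ℕ} {A : Matrix (Fin n) (Fin n) ℝ}

theorem abs_dotProduct_mulVec_le {ι : Type*} [Fintype ι] (A : Matrix ι ι ℝ)
    (v : EuclideanSpace ℝ ι) : |v ⬝ᵥ A *ᵥ v| ≤ (∑ i, ∑ j, |A i j|) * ‖v‖ ^ 2 := by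
  have hv : ∀ i, |v i| ≤ ‖v‖ := fun i => PiLp.norm_apply_le v i
  simp only [dotProduct, Matrix.mulVec, Finset.mul_sum, Finset.sum_mul]
  refine (Finset.abs_sum_le_sum_abs _ _).trans (Finset.sum_le_sum fun i _ =>
    (Finset.abs_sum_le_sum_abs _ _).trans (Finset.sum_le_sum fun j _ => ?_))
  calc |v i * (A i j * v j)| = |A i j| * (|v i| * |v j|) := by rw [abs_mul, abs_mul]; ring
    _ ≤ |A i j| * (‖v‖ * ‖v‖) := by gcongr <;> exact hv _
    _ = |A i j| * ‖v‖ ^ 2 := by rw [sq]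

open scoped MatrixOrder in
theorem leastEigenvalue_mul_le (hA : A.IsHermitian) (v : EuclideanSpace ℝ (Fin n)) :
    leastEigenvalue A * ‖v‖ ^ 2 ≤ v ⬝ᵥ A *ᵥ v := by
  have hle : algebraMap ℝ _ (leastEigenvalue A) ≤ A :=
    algebraMap_le_of_le_spectrum (fun μ hμ => csInf_le (by
      rw [hA.spectrum_real_eq_range_eigenvalues]
      exact (finite_range _).bddBelow) hμ) hA
  have h := (Matrix.le_iff.1 hle).dotProduct_mulVec_nonneg v
  rw [Matrix.sub_mulVec, dotProduct_sub, sub_nonneg, Algebra.algebraMap_eq_smul_one,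
    Matrix.smul_mulVec, Matrix.one_mulVec, dotProduct_smul, star_trivial] at h
  have hv : (v : Fin n → ℝ) ⬝ᵥ v = ‖v‖ ^ 2 := by
    simp only [EuclideanSpace.real_norm_sq_eq, dotProduct, ← sq]
  rwa [hv, smul_eq_mul] at h

end QuadraticForm

section Gram

variable {n d m : ℕ} {x : Fin n → EuclideanSpace ℝ (Fin d)}

/-- The activation patterns compatible with the weights `w`: all choices of a subderivative of ReLU
at each preactivation `⟪w r, x i⟫`. -/
def subderivativePatterns (x : Fin n → EuclideanSpace ℝ (Fin d))
    (w : Fin m → EuclideanSpace ℝ (Fin d)) : Set (Fin n → Fin m → ℝ) :=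
  {ξ | ∀ i r, ξ i r ∈ reluSubdifferential ⟪w r, x i⟫}

/-- The Gram matrix of the activation pattern `ξ`, which drives the evolution of the predictions
along the gradient flow. It is the matrix `H(t)` of the paper when `ξ` is the pattern at time
`t`. -/
noncomputable def activationGram (x : Fin n → EuclideanSpace ℝ (Fin d)) (ξ : Fin n → Fin m → ℝ) :
    Matrix (Fin n) (Fin n) ℝ :=
  .of fun i j => (1 / (m : ℝ)) * ∑ r, ξ i r * ξ j r * ⟪x i, x j⟫

/-- All eigenvalues of the Gram matrices of the activation patterns at `w` are at least `κ`. -/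
def GramLowerBound (x : Fin n → EuclideanSpace ℝ (Fin d)) (κ : ℝ)
    (w : Fin m → EuclideanSpace ℝ (Fin d)) : Prop :=
  ∀ ξ ∈ subderivativePatterns x w, ∀ v : EuclideanSpace ℝ (Fin n),
    κ * ‖v‖ ^ 2 ≤ v ⬝ᵥ activationGram x ξ *ᵥ v

end Gram

section GradientFlow

variable {n d m : ℕ} {x : Fin n → EuclideanSpace ℝ (Fin d)} {y : EuclideanSpace ℝ (Fin n)}
  {a : Fin m → ℝ} {w : Fin m → EuclideanSpace ℝ (Fin d)}
  {W : ℝ → Fin m → EuclideanSpace ℝ (Fin d)} {ξ : Fin n → Fin m → ℝ} {κ R t T : ℝ}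

theorem norm_gradientFormula_le (hx : ∀ i, ‖x i‖ ≤ 1) (ha : ∀ r, a r ^ 2 = 1)
    (hξ : ξ ∈ subderivativePatterns x w) (r : Fin m) :
    ‖gradientFormula x y a w ξ r‖ ≤ √(n / m) * ‖prediction x a w - y‖ := by
  have habs : ∀ r, |a r| = 1 := fun r => by
    rw [← sq_eq_sq₀ (abs_nonneg _) zero_le_one, sq_abs, ha, one_pow]
  have hterm : ∀ i, ‖((network w a (x i) - y i) * a r * ξ i r) • x i‖ ≤
      |network w a (x i) - y i| := fun i => by
    rw [norm_smul, Real.norm_eq_abs, abs_mul, abs_mul, habs r, mul_one, mul_assoc]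
    exact mul_le_of_le_one_right (abs_nonneg _) (mul_le_one₀
      (abs_le_one_of_mem_reluSubdifferential (hξ i r)) (norm_nonneg _) (hx i))
  have hsum : ∑ i, |network w a (x i) - y i| ≤ √n * ‖prediction x a w - y‖ := by
    rw [← Real.sqrt_sq (norm_nonneg (prediction x a w - y)), ← Real.sqrt_mul (Nat.cast_nonneg n)]
    refine Real.le_sqrt_of_sq_le ?_
    rw [EuclideanSpace.real_norm_sq_eq]
    simpa [prediction] using sq_sum_le_card_mul_sum_sq (s := Finset.univ)
      (f := fun i => |network w a (x i) - y i|)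
  calc ‖gradientFormula x y a w ξ r‖
      ≤ 1 / √m * ∑ i, |network w a (x i) - y i| := by
        rw [gradientFormula, norm_smul, Real.norm_of_nonneg (by positivity)]
        gcongr
        exact norm_sum_le_of_le _ fun i _ => hterm i
    _ ≤ 1 / √m * (√n * ‖prediction x a w - y‖) := by gcongr
    _ = √(n / m) * ‖prediction x a w - y‖ := by rw [Real.sqrt_div (Nat.cast_nonneg n)]; ring

theorem hasDerivAt_network (ha : ∀ r, a r ^ 2 = 1) (hξ : ξ ∈ subderivativePatterns x (W t))
    (hW : ∀ r, HasDerivAt (fun s => W s r) (-gradientFormula x y a (W t) ξ r) t)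
    (hd : ∀ i r, DifferentiableAt ℝ (fun s => relu ⟪W s r, x i⟫) t) (i : Fin n) :
    HasDerivAt (fun s => network (W s) a (x i))
      (-(activationGram x ξ *ᵥ (prediction x a (W t) - y).ofLp) i) t := by
  have hz : ∀ r, HasDerivAt (fun s => ⟪W s r, x i⟫)
      ⟪-gradientFormula x y a (W t) ξ r, x i⟫ t := fun r => by
    simpa using (hW r).inner ℝ (hasDerivAt_const t (x i))
  have hnet : HasDerivAt (fun s => network (W s) a (x i)) _ t :=
    (HasDerivAt.fun_sum (u := Finset.univ) fun r _ =>
      (hasDerivAt_relu_comp (hz r) (hd i r) (hξ i r)).const_mul (a r)).const_mul (1 / √m)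
  refine hnet.congr_deriv ?_
  have hm : 1 / (m : ℝ) = 1 / √m * (1 / √m) := by
    rw [div_mul_div_comm, one_mul, Real.mul_self_sqrt (Nat.cast_nonneg m)]
  simp only [activationGram, gradientFormula, prediction, Matrix.mulVec, dotProduct,
    Matrix.of_apply, PiLp.sub_apply, inner_neg_left, real_inner_smul_left, sum_inner, hm,
    Finset.mul_sum, Finset.sum_mul, mul_neg, Finset.sum_neg_distrib]
  rw [Finset.sum_comm]
  refine congrArg _ (Finset.sum_congr rfl fun j _ => Finset.sum_congr rfl fun r _ => ?_)
  rw [real_inner_comm (x i) (x j)]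
  linear_combination (1 / √m * (1 / √m) * ξ i r * ξ j r * ⟪x i, x j⟫
    * (network (W t) a (x j) - y j)) * ha r

theorem hasDerivAt_norm_prediction_sub_sq (ha : ∀ r, a r ^ 2 = 1)
    (hξ : ξ ∈ subderivativePatterns x (W t))
    (hW : ∀ r, HasDerivAt (fun s => W s r) (-gradientFormula x y a (W t) ξ r) t)
    (hd : ∀ i r, DifferentiableAt ℝ (fun s => relu ⟪W s r, x i⟫) t) :
    HasDerivAt (fun s => ‖prediction x a (W s) - y‖ ^ 2)
      (-2 * ((prediction x a (W t) - y) ⬝ᵥ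
        activationGram x ξ *ᵥ (prediction x a (W t) - y).ofLp)) t := by
  simp only [EuclideanSpace.real_norm_sq_eq, PiLp.sub_apply]
  refine (HasDerivAt.fun_sum fun i _ =>
    ((hasDerivAt_network ha hξ hW hd i).sub_const (y i)).fun_pow 2).congr_deriv ?_
  rw [dotProduct, Finset.mul_sum]
  refine Finset.sum_congr rfl fun i _ => ?_
  simp only [prediction, PiLp.sub_apply]
  ring

namespace IsGradientFlow

theorem absolutelyContinuous_relu_inner (hW : IsGradientFlow x y a W) (hT : 0 ≤ T) (r : Fin m)
    (v : EuclideanSpace ℝ (Fin d)) :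
    AbsolutelyContinuousOnInterval (fun t => relu ⟪W t r, v⟫) 0 T :=
  absolutelyContinuousOnInterval_lipschitzWith_comp (f := fun t => W t r)
    (g := fun w => relu ⟪w, v⟫) (lipschitzWith_relu_inner v)
    (hW.absolutelyContinuous r T hT)

theorem absolutelyContinuous_network (hW : IsGradientFlow x y a W) (hT : 0 ≤ T)
    (v : EuclideanSpace ℝ (Fin d)) :
    AbsolutelyContinuousOnInterval (fun t => network (W t) a v) 0 T := by
  unfold network
  exact (absolutelyContinuousOnInterval_sum fun r _ =>
    (hW.absolutelyContinuous_relu_inner hT r v).const_mul (a r)).const_mul (1 / √m)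

theorem absolutelyContinuous_norm_prediction_sub_sq (hW : IsGradientFlow x y a W) (hT : 0 ≤ T) :
    AbsolutelyContinuousOnInterval (fun t => ‖prediction x a (W t) - y‖ ^ 2) 0 T := by
  have hres : ∀ i, AbsolutelyContinuousOnInterval (fun t => network (W t) a (x i) - y i) 0 T :=
    fun i => (hW.absolutelyContinuous_network hT (x i)).fun_sub
      (LipschitzWith.const (y i)).lipschitzOnWith.absolutelyContinuousOnInterval
  have hnorm : ∀ t, ‖prediction x a (W t) - y‖ ^ 2 =
      ∑ i, (network (W t) a (x i) - y i) * (network (W t) a (x i) - y i) := fun t => by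
    simp only [EuclideanSpace.real_norm_sq_eq, prediction, PiLp.sub_apply, ← sq]
  simp only [hnorm]
  exact absolutelyContinuousOnInterval_sum fun i _ => (hres i).fun_mul (hres i)

theorem ae_hasDerivAt (hW : IsGradientFlow x y a W) (ha : ∀ r, a r ^ 2 = 1) (hT : 0 ≤ T) :
    ∀ᵐ t, t ∈ Ioo 0 T → ∃ ξ ∈ subderivativePatterns x (W t),
      (∀ r, HasDerivAt (fun s => W s r) (-gradientFormula x y a (W t) ξ r) t) ∧
      HasDerivAt (fun s => ‖prediction x a (W s) - y‖ ^ 2)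
        (-2 * ((prediction x a (W t) - y) ⬝ᵥ
          activationGram x ξ *ᵥ (prediction x a (W t) - y).ofLp)) t := by
  have hincl := (ae_restrict_iff' measurableSet_Ioi).1 hW.inclusion
  have hdiff : ∀ᵐ t : ℝ, ∀ i r, t ∈ uIcc 0 T →
      DifferentiableAt ℝ (fun s => relu ⟪W s r, x i⟫) t :=
    ae_all_iff.2 fun i => ae_all_iff.2 fun r =>
      (hW.absolutelyContinuous_relu_inner hT r (x i)).ae_differentiableAt
  filter_upwards [hincl, hdiff] with t htG htd ht
  obtain ⟨G, ⟨ξ, hξ, rfl⟩, hG⟩ := htG ht.1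
  exact ⟨ξ, hξ, hG, hasDerivAt_norm_prediction_sub_sq ha hξ hG fun i r =>
    htd i r (Icc_subset_uIcc (Ioo_subset_Icc_self ht))⟩

theorem norm_prediction_sub_sq_le (hW : IsGradientFlow x y a W) (ha : ∀ r, a r ^ 2 = 1)
    (hT : 0 ≤ T) (hgram : ∀ t ∈ Ioo 0 T, GramLowerBound x κ (W t)) :
    ‖prediction x a (W T) - y‖ ^ 2 ≤
      Real.exp (-(2 * κ) * T) * ‖prediction x a (W 0) - y‖ ^ 2 := by
  have hdecay := le_exp_mul_of_ae_deriv_le (c := -(2 * κ)) hT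
    (hW.absolutelyContinuous_norm_prediction_sub_sq hT) (by
      filter_upwards [hW.ae_hasDerivAt ha hT] with t hderiv ht
      obtain ⟨ξ, hξ, -, hloss⟩ := hderiv ht
      rw [hloss.deriv]
      linarith [hgram t ht ξ hξ (prediction x a (W t) - y)])
  rwa [sub_zero] at hdecay

theorem norm_sub_le (hW : IsGradientFlow x y a W) (hx : ∀ i, ‖x i‖ ≤ 1)
    (ha : ∀ r, a r ^ 2 = 1) (hκ : 0 < κ) (hT : 0 ≤ T)
    (hgram : ∀ t ∈ Ioo 0 T, GramLowerBound x κ (W t)) (r : Fin m) :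
    ‖W T r - W 0 r‖ ≤ √(n / m) * ‖prediction x a (W 0) - y‖ / κ := by
  set c : ℝ := √(n / m) * ‖prediction x a (W 0) - y‖ with hc
  have hres : ∀ t ∈ Ioo 0 T,
      ‖prediction x a (W t) - y‖ ≤ Real.exp (-κ * t) * ‖prediction x a (W 0) - y‖ := by
    refine fun t ht => le_of_sq_le_sq ?_ (by positivity)
    have hexp : Real.exp (-κ * t) ^ 2 = Real.exp (-(2 * κ) * t) := by
      rw [← Real.exp_nat_mul]
      ring_nf
    rw [mul_pow, hexp]
    exact hW.norm_prediction_sub_sq_le ha ht.1.le fun s hs => hgram s ⟨hs.1, hs.2.trans ht.2⟩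
  have hmajorant : ∀ t, HasDerivAt (fun s => -(c / κ) * Real.exp (-κ * s))
      (c * Real.exp (-κ * t)) t := fun t => by
    refine ((((hasDerivAt_id t).const_mul (-κ)).exp).const_mul (-(c / κ))).congr_deriv ?_
    simp only [id_eq]
    field_simp
  have hmove := norm_sub_le_of_ae_norm_deriv_le hT (hW.absolutelyContinuous r T hT)
    (F := fun s => -(c / κ) * Real.exp (-κ * s))
    (ContDiffOn.absolutelyContinuousOnInterval (by fun_prop)) (by
      filter_upwards [hW.ae_hasDerivAt ha hT] with t hderiv ht
      obtain ⟨ξ, hξ, hG, -⟩ := hderiv ht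
      refine ⟨(hG r).differentiableAt, ?_⟩
      rw [(hG r).deriv, norm_neg, (hmajorant t).deriv]
      calc ‖gradientFormula x y a (W t) ξ r‖
          ≤ √(n / m) * ‖prediction x a (W t) - y‖ := norm_gradientFormula_le hx ha hξ r
        _ ≤ √(n / m) * (Real.exp (-κ * t) * ‖prediction x a (W 0) - y‖) := by
          gcongr
          exact hres t ht
        _ = c * Real.exp (-κ * t) := by rw [hc]; ring)
  rw [mul_zero, Real.exp_zero] at hmove
  have htail : 0 ≤ c / κ * Real.exp (-κ * T) := by positivity
  linarith

theorem norm_prediction_sub_sq_le_of_gramLowerBound (hW : IsGradientFlow x y a W)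
    (hx : ∀ i, ‖x i‖ ≤ 1) (ha : ∀ r, a r ^ 2 = 1) (hκ : 0 < κ)
    (hgram : ∀ w, (∀ r, ‖w r - W 0 r‖ < R) → GramLowerBound x κ w)
    (hR : √(n / m) * ‖prediction x a (W 0) - y‖ / κ < R) (hT : 0 ≤ T) :
    ‖prediction x a (W T) - y‖ ^ 2 ≤
      Real.exp (-(2 * κ) * T) * ‖prediction x a (W 0) - y‖ ^ 2 := by
  have hR_pos : 0 < R := lt_of_le_of_lt (by positivity) hR
  have hcont : ContinuousOn (fun t => ‖W t - W 0‖) (Icc 0 T) := by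
    refine ((continuousOn_pi.2 fun r => ?_).sub continuousOn_const).norm
    rw [← uIcc_of_le hT]
    exact (hW.absolutelyContinuous r T hT).continuousOn
  have hclose : ∀ t ∈ Icc 0 T, ‖W t - W 0‖ < R := fun t =>
    lt_of_forall_Ico_lt hcont fun s hs hlt => (pi_norm_lt_iff hR_pos).2 fun r =>
      (hW.norm_sub_le hx ha hκ hs.1 (fun u hu =>
        hgram _ ((pi_norm_lt_iff hR_pos).1 (hlt u (Ioo_subset_Ico_self hu)))) r).trans_lt hR
  exact hW.norm_prediction_sub_sq_le ha hT fun t ht =>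
    hgram _ ((pi_norm_lt_iff hR_pos).1 (hclose t (Ioo_subset_Icc_self ht)))

end IsGradientFlow

end GradientFlow

section GramPerturbation

variable {n d m : ℕ} {x : Fin n → EuclideanSpace ℝ (Fin d)}
  {w w' : Fin m → EuclideanSpace ℝ (Fin d)} {ξ ξ₀ : Fin n → Fin m → ℝ} {κ κ' R : ℝ}

/-- The activation pattern at the weights `w`, with the convention that a neuron with zero
preactivation is active. -/
noncomputable def activation (x : Fin n → EuclideanSpace ℝ (Fin d))
    (w : Fin m → EuclideanSpace ℝ (Fin d)) (i : Fin n) (r : Fin m) : ℝ :=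
  (Ici 0).indicator (fun _ => 1) ⟪w r, x i⟫

/-- The contribution of a single neuron with weight `w` to the `(i, j)` entry of the Gram matrix;
its Gaussian mean is the entry of `gramInfinity`. -/
noncomputable def coactivation (x : Fin n → EuclideanSpace ℝ (Fin d)) (i j : Fin n) :
    EuclideanSpace ℝ (Fin d) → ℝ :=
  {w | 0 ≤ ⟪w, x i⟫ ∧ 0 ≤ ⟪w, x j⟫}.indicator fun _ => ⟪x i, x j⟫

/-- The weights at which an input `v` can change its activation under a displacement of the weight
by at most `R`. -/
def boundaryStrip {E : Type*} [NormedAddCommGroup E] [InnerProductSpace ℝ E] (R : ℝ) (v : E) :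
    Set E :=
  {w | |⟪w, v⟫| ≤ R * ‖v‖}

/-- An upper bound for the entrywise `ℓ¹` distance between `gramInfinity x` and the Gram matrices at
all weights within distance `R` of `w`: the sampling error at `w`, plus the effect of the neurons
which are close to an activation boundary. -/
noncomputable def gramFluctuation (x : Fin n → EuclideanSpace ℝ (Fin d)) (R : ℝ)
    (w : Fin m → EuclideanSpace ℝ (Fin d)) : ℝ :=
  ∑ i, ∑ j, |activationGram x (activation x w) i j - gramInfinity x i j| +
    2 * n / m * ∑ i, ∑ r, (boundaryStrip R (x i)).indicator 1 (w r)

theorem GramLowerBound.mono (h : GramLowerBound x κ w) (hκ : κ' ≤ κ) : GramLowerBound x κ' w :=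
  fun ξ hξ v => (mul_le_mul_of_nonneg_right hκ (sq_nonneg _)).trans (h ξ hξ v)

theorem activation_mem_subderivativePatterns (x : Fin n → EuclideanSpace ℝ (Fin d))
    (w : Fin m → EuclideanSpace ℝ (Fin d)) : activation x w ∈ subderivativePatterns x w := by
  intro i r
  by_cases h : 0 ≤ ⟪w r, x i⟫
  · simp [activation, reluSubdifferential, h, not_lt.2 h]
  · simp [activation, reluSubdifferential, h, le_of_not_ge h]

theorem activationGram_activation (x : Fin n → EuclideanSpace ℝ (Fin d))
    (w : Fin m → EuclideanSpace ℝ (Fin d)) (i j : Fin n) :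
    activationGram x (activation x w) i j = (1 / (m : ℝ)) * ∑ r, coactivation x i j (w r) := by
  refine congrArg _ (Finset.sum_congr rfl fun r _ => ?_)
  by_cases hi : 0 ≤ ⟪w r, x i⟫ <;> by_cases hj : 0 ≤ ⟪w r, x j⟫ <;>
    simp [activation, coactivation, indicator, hi, hj]

theorem gramInfinity_apply (x : Fin n → EuclideanSpace ℝ (Fin d)) (i j : Fin n) :
    gramInfinity x i j =
      ∫ w, coactivation x i j w ∂(stdGaussian (EuclideanSpace ℝ (Fin d))) :=
  rfl

theorem isHermitian_gramInfinity (x : Fin n → EuclideanSpace ℝ (Fin d)) :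
    (gramInfinity x).IsHermitian := by
  ext i j
  simp only [Matrix.conjTranspose_apply, star_trivial, gramInfinity_apply, coactivation,
    real_inner_comm (x i) (x j), and_comm]

theorem sum_abs_activationGram_sub_le (hx : ∀ i, ‖x i‖ ≤ 1) (hξ : ∀ i r, |ξ i r| ≤ 1)
    (hξ₀ : ∀ i r, |ξ₀ i r| ≤ 1) :
    ∑ i, ∑ j, |activationGram x ξ i j - activationGram x ξ₀ i j| ≤
      2 * n / m * ∑ i, ∑ r, |ξ i r - ξ₀ i r| := by
  have hterm : ∀ i j r, |ξ i r * ξ j r * ⟪x i, x j⟫ - ξ₀ i r * ξ₀ j r * ⟪x i, x j⟫| ≤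
      |ξ i r - ξ₀ i r| + |ξ j r - ξ₀ j r| := fun i j r => by
    have hinner : |⟪x i, x j⟫| ≤ 1 :=
      (abs_real_inner_le_norm _ _).trans (mul_le_one₀ (hx i) (norm_nonneg _) (hx j))
    calc |ξ i r * ξ j r * ⟪x i, x j⟫ - ξ₀ i r * ξ₀ j r * ⟪x i, x j⟫|
        = |(ξ i r - ξ₀ i r) * ξ j r + ξ₀ i r * (ξ j r - ξ₀ j r)| * |⟪x i, x j⟫| := by
          rw [← abs_mul]; ring_nf
      _ ≤ |(ξ i r - ξ₀ i r) * ξ j r + ξ₀ i r * (ξ j r - ξ₀ j r)| :=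
          mul_le_of_le_one_right (abs_nonneg _) hinner
      _ ≤ |ξ i r - ξ₀ i r| * |ξ j r| + |ξ₀ i r| * |ξ j r - ξ₀ j r| := by
          rw [← abs_mul, ← abs_mul]; exact abs_add_le _ _
      _ ≤ |ξ i r - ξ₀ i r| + |ξ j r - ξ₀ j r| :=
          add_le_add (mul_le_of_le_one_right (abs_nonneg _) (hξ j r))
            (mul_le_of_le_one_left (abs_nonneg _) (hξ₀ i r))
  have hentry : ∀ i j, |activationGram x ξ i j - activationGram x ξ₀ i j| ≤
      1 / m * (∑ r, |ξ i r - ξ₀ i r| + ∑ r, |ξ j r - ξ₀ j r|) := fun i j => by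
    rw [activationGram, activationGram, Matrix.of_apply, Matrix.of_apply, ← mul_sub,
      ← Finset.sum_sub_distrib, abs_mul, abs_of_nonneg (by positivity), ← Finset.sum_add_distrib]
    gcongr
    exact (Finset.abs_sum_le_sum_abs _ _).trans (Finset.sum_le_sum fun r _ => hterm i j r)
  refine (Finset.sum_le_sum fun i _ => Finset.sum_le_sum fun j _ => hentry i j).trans_eq ?_
  simp only [← Finset.mul_sum, Finset.sum_add_distrib, Finset.sum_const, Finset.card_univ,
    Fintype.card_fin, nsmul_eq_mul]
  ring

theorem sum_abs_sub_activation_le (hw : ∀ r, ‖w' r - w r‖ ≤ R)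
    (hξ : ξ ∈ subderivativePatterns x w') :
    ∑ i, ∑ r, |ξ i r - activation x w i r| ≤
      ∑ i, ∑ r, (boundaryStrip R (x i)).indicator 1 (w r) := by
  refine Finset.sum_le_sum fun i _ => Finset.sum_le_sum fun r _ =>
    abs_sub_le_indicator_of_mem_reluSubdifferential (ρ := R * ‖x i‖) (hξ i r)
      (activation_mem_subderivativePatterns x w i r) ?_
  rw [← inner_sub_left]
  exact (abs_real_inner_le_norm _ _).trans (by gcongr; exact hw r)

theorem gramLowerBound_sub_gramFluctuation (hx : ∀ i, ‖x i‖ ≤ 1) (hw : ∀ r, ‖w' r - w r‖ ≤ R) :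
    GramLowerBound x (leastEigenvalue (gramInfinity x) - gramFluctuation x R w) w' := by
  intro ξ hξ v
  have hdist : ∑ i, ∑ j, |(activationGram x ξ - gramInfinity x) i j| ≤ gramFluctuation x R w := by
    have hmove : ∑ i, ∑ j, |activationGram x ξ i j - activationGram x (activation x w) i j| ≤
        2 * n / m * ∑ i, ∑ r, (boundaryStrip R (x i)).indicator 1 (w r) :=
      (sum_abs_activationGram_sub_le hx
        (fun i r => abs_le_one_of_mem_reluSubdifferential (hξ i r)) fun i r =>
          abs_le_one_of_mem_reluSubdifferential
            (activation_mem_subderivativePatterns x w i r)).trans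
        (mul_le_mul_of_nonneg_left (sum_abs_sub_activation_le hw hξ) (by positivity))
    refine le_trans ?_ (add_le_add_right hmove _)
    simp only [← Finset.sum_add_distrib]
    exact Finset.sum_le_sum fun i _ => Finset.sum_le_sum fun j _ =>
      (abs_sub_le _ (activationGram x (activation x w) i j) _).trans_eq (add_comm _ _)
  have hquad := (abs_le.1 (abs_dotProduct_mulVec_le (activationGram x ξ - gramInfinity x) v)).1
  rw [Matrix.sub_mulVec, dotProduct_sub] at hquad
  linarith [leastEigenvalue_mul_le (isHermitian_gramInfinity x) v,
    mul_le_mul_of_nonneg_right hdist (sq_nonneg ‖v‖)]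

theorem norm_coactivation_le (hx : ∀ i, ‖x i‖ ≤ 1) (i j : Fin n) (w : EuclideanSpace ℝ (Fin d)) :
    ‖coactivation x i j w‖ ≤ 1 :=
  (norm_indicator_le_norm_self _ w).trans
    ((norm_inner_le_norm _ _).trans (mul_le_one₀ (hx i) (norm_nonneg _) (hx j)))

theorem measurable_coactivation (x : Fin n → EuclideanSpace ℝ (Fin d)) (i j : Fin n) :
    Measurable (coactivation x i j) := by
  have hactive : ∀ i, MeasurableSet {w : EuclideanSpace ℝ (Fin d) | 0 ≤ ⟪w, x i⟫} := fun i =>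
    measurableSet_le measurable_const (by fun_prop)
  exact measurable_const.indicator ((hactive i).inter (hactive j))

theorem measurableSet_boundaryStrip {E : Type*} [NormedAddCommGroup E] [InnerProductSpace ℝ E]
    [MeasurableSpace E] [OpensMeasurableSpace E] (R : ℝ) (v : E) :
    MeasurableSet (boundaryStrip R v) :=
  measurableSet_le (Continuous.measurable (by fun_prop)) measurable_const

end GramPerturbation

section LeastEigenvalue

variable {n d : ℕ}

theorem leastEigenvalue_gramInfinity_le (x : Fin n → EuclideanSpace ℝ (Fin d)) (i : Fin n) :
    leastEigenvalue (gramInfinity x) ≤ ‖x i‖ ^ 2 := by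
  have hdiag : leastEigenvalue (gramInfinity x) ≤ gramInfinity x i i := by
    simpa using leastEigenvalue_mul_le (isHermitian_gramInfinity x) (EuclideanSpace.single i 1)
  have hbound : ∀ w, ‖coactivation x i i w‖ ≤ ‖x i‖ ^ 2 := fun w =>
    (norm_indicator_le_norm_self _ w).trans_eq (by simp)
  have hentry := norm_integral_le_of_norm_le_const
    (μ := stdGaussian (EuclideanSpace ℝ (Fin d))) (ae_of_all _ hbound)
  rw [probReal_univ, mul_one, ← gramInfinity_apply] at hentry
  exact hdiag.trans ((Real.le_norm_self _).trans hentry)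

theorem pos_of_leastEigenvalue_pos {A : Matrix (Fin n) (Fin n) ℝ} (h : 0 < leastEigenvalue A) :
    0 < n := by
  rcases n.eq_zero_or_pos with rfl | hn
  · simp [leastEigenvalue, spectrum.of_subsingleton] at h
  · exact hn

end LeastEigenvalue

section Sampling

variable {Ω : Type*} [MeasurableSpace Ω] {μ : Measure Ω} [IsProbabilityMeasure μ]

theorem integral_abs_sub_integral_le_sqrt_variance {X : Ω → ℝ} (hX : MemLp X 2 μ) :
    ∫ ω, |X ω - μ[X]| ∂μ ≤ √Var[X; μ] := by
  have hnonneg : 0 ≤ Var[fun ω => |X ω - μ[X]|; μ] := variance_nonneg _ _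
  have hdev : MemLp (fun ω => |X ω - μ[X]|) 2 μ := (hX.sub (memLp_const _)).abs
  rw [variance_eq_sub hdev] at hnonneg
  refine Real.le_sqrt_of_sq_le ((sub_nonneg.1 hnonneg).trans_eq ?_)
  rw [variance_eq_integral hX.1.aemeasurable]
  simp only [Pi.pow_apply, sq_abs]

theorem integral_abs_sampleMean_sub_le {m : ℕ} (hm : 0 < m) {g : Ω → ℝ} (hg : Measurable g)
    (hg1 : ∀ z, ‖g z‖ ≤ 1) :
    ∫ w, |1 / m * ∑ r, g (w r) - μ[g]| ∂(Measure.pi fun _ : Fin m => μ) ≤ 1 / √m := by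
  have hm₀ : (m : ℝ) ≠ 0 := by positivity
  have hgLp : MemLp g 2 μ := MemLp.of_bound hg.aestronglyMeasurable 1 (ae_of_all _ hg1)
  have hterm : ∀ r : Fin m, MemLp (fun w : Fin m → Ω => g (w r)) 2 (Measure.pi fun _ => μ) :=
    fun r => hgLp.comp_measurePreserving (measurePreserving_eval _ r)
  have hmean : ∫ w, 1 / m * ∑ r, g (w r) ∂(Measure.pi fun _ : Fin m => μ) = μ[g] := by
    rw [integral_const_mul, integral_finsetSum _ fun r _ => (hterm r).integrable one_le_two]
    simp only [integral_comp_eval (μ := fun _ : Fin m => μ) hg.aestronglyMeasurable,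
      Finset.sum_const, Finset.card_univ, Fintype.card_fin, nsmul_eq_mul]
    field_simp
  have hvar : Var[fun w => 1 / m * ∑ r, g (w r); Measure.pi fun _ : Fin m => μ] ≤ 1 / (m : ℝ) := by
    have hsum := variance_sum_pi (μ := fun _ : Fin m => μ) (X := fun _ => g) fun _ => hgLp
    have hg_var : Var[g; μ] ≤ 1 := by
      simpa using variance_le_sq_of_bounded (a := -1) (b := 1)
        (ae_of_all _ fun z => abs_le.1 (hg1 z)) hg.aemeasurable
    rw [variance_const_mul, ← Finset.sum_fn, hsum, Finset.sum_const, Finset.card_univ,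
      Fintype.card_fin, nsmul_eq_mul]
    calc (1 / (m : ℝ)) ^ 2 * (m * Var[g; μ]) ≤ (1 / (m : ℝ)) ^ 2 * (m * 1) := by gcongr
      _ = 1 / (m : ℝ) := by field_simp
  have hdev := integral_abs_sub_integral_le_sqrt_variance
    ((memLp_finsetSum Finset.univ fun r _ => hterm r).const_mul (1 / (m : ℝ)))
  rw [hmean] at hdev
  refine (hdev.trans (Real.sqrt_le_sqrt hvar)).trans_eq ?_
  rw [Real.sqrt_div zero_le_one, Real.sqrt_one]

theorem measure_ge_le_of_integral_le {μ : Measure Ω} [IsFiniteMeasure μ] {f : Ω → ℝ} {ε η : ℝ}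
    (hf₀ : 0 ≤ f) (hf : Integrable f μ) (hε : 0 < ε) (h : ∫ ω, f ω ∂μ ≤ ε * η) :
    μ {ω | ε ≤ f ω} ≤ ENNReal.ofReal η := by
  rw [← ofReal_measureReal]
  exact ENNReal.ofReal_le_ofReal <| le_of_mul_le_mul_left
    ((mul_meas_ge_le_integral_of_nonneg (ae_of_all _ hf₀) hf ε).trans h) hε

theorem exists_measurableSet_subset_of_measure_compl_le {B : Set Ω} {η : ℝ} (hη : 0 ≤ η)
    (h : μ Bᶜ ≤ ENNReal.ofReal η) :
    ∃ E ⊆ B, MeasurableSet E ∧ ENNReal.ofReal (1 - η) ≤ μ E := by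
  have hmeas := measurableSet_toMeasurable μ Bᶜ
  refine ⟨(toMeasurable μ Bᶜ)ᶜ, compl_subset_comm.1 (subset_toMeasurable μ _), hmeas.compl, ?_⟩
  rw [prob_compl_eq_one_sub hmeas, measure_toMeasurable, ENNReal.ofReal_sub _ hη,
    ENNReal.ofReal_one]
  exact tsub_le_tsub_left h 1

end Sampling

section Gaussian

variable {E : Type*} [NormedAddCommGroup E] [InnerProductSpace ℝ E] [FiniteDimensional ℝ E]
  [MeasurableSpace E] [BorelSpace E]

theorem memLp_inner_stdGaussian (v : E) : MemLp (fun w => ⟪w, v⟫) 2 (stdGaussian E) := by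
  simp_rw [real_inner_comm v]
  exact IsGaussian.memLp_dual (stdGaussian E) (innerSL ℝ v) 2 (by simp)

theorem integral_inner_sq_stdGaussian (v : E) : ∫ w, ⟪w, v⟫ ^ 2 ∂(stdGaussian E) = ‖v‖ ^ 2 := by
  have hvar := variance_dual_stdGaussian (innerSL ℝ v)
  rw [variance_of_integral_eq_zero (by fun_prop) (integral_strongDual_stdGaussian _),
    innerSL_apply_norm] at hvar
  simpa only [innerSL_apply_apply, real_inner_comm] using hvar

theorem gaussianReal_real_Icc_le (c : ℝ) {v : NNReal} (hv : v ≠ 0) {a b : ℝ} (hab : a ≤ b) :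
    (gaussianReal c v).real (Icc a b) ≤ (b - a) / √(2 * Real.pi * v) := by
  have hpdf : ∀ z, gaussianPDFReal c v z ≤ (√(2 * Real.pi * v))⁻¹ := fun z => by
    rw [gaussianPDFReal_def]
    exact mul_le_of_le_one_right (by positivity) (Real.exp_le_one_iff.2
      (div_nonpos_of_nonpos_of_nonneg (neg_nonpos.2 (sq_nonneg _)) (by positivity)))
  rw [measureReal_def, gaussianReal_apply_eq_integral c hv,
    ENNReal.toReal_ofReal (integral_nonneg fun _ => gaussianPDFReal_nonneg _ _ _)]
  refine (setIntegral_mono (integrable_gaussianPDFReal c v).integrableOn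
    (integrableOn_const measure_Icc_lt_top.ne) hpdf).trans_eq ?_
  rw [setIntegral_const, Real.volume_real_Icc_of_le hab, smul_eq_mul, div_eq_mul_inv]

theorem stdGaussian_real_boundaryStrip_le {v : E} (hv : v ≠ 0) {R : ℝ} (hR : 0 ≤ R) :
    (stdGaussian E).real (boundaryStrip R v) ≤ R := by
  have hnorm : 0 < ‖v‖ := norm_pos_iff.2 hv
  have hpre : boundaryStrip R v = innerSL ℝ v ⁻¹' Icc (-(R * ‖v‖)) (R * ‖v‖) := by
    ext w
    rw [mem_preimage, mem_Icc, ← abs_le, innerSL_apply_apply, real_inner_comm]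
    rfl
  have hmap := IsGaussian.map_eq_gaussianReal (μ := stdGaussian E) (innerSL ℝ v)
  rw [integral_strongDual_stdGaussian, variance_dual_stdGaussian, innerSL_apply_norm] at hmap
  rw [hpre, ← map_measureReal_apply (by fun_prop) measurableSet_Icc, hmap]
  refine (gaussianReal_real_Icc_le 0 (by simpa using hv) (by nlinarith)).trans ?_
  have hsqrt : 2 * ‖v‖ ≤ √(2 * Real.pi * (‖v‖ ^ 2).toNNReal) := by
    refine Real.le_sqrt_of_sq_le ?_
    rw [Real.coe_toNNReal _ (sq_nonneg _)]
    nlinarith [Real.pi_gt_three, sq_nonneg ‖v‖]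
  rw [div_le_iff₀ (by linarith)]
  nlinarith [mul_le_mul_of_nonneg_left hsqrt hR]

end Gaussian

section Rademacher

/-- The uniform law on `{-1, 1}`, which is the law of each output weight. -/
noncomputable abbrev signLaw : Measure ℝ := uniformOn ({-1, 1} : Set ℝ)

instance isProbabilityMeasure_signLaw : IsProbabilityMeasure signLaw :=
  isProbabilityMeasure_uniformOn (by simp) (by simp)

theorem ae_signLaw_sq : ∀ᵐ s ∂signLaw, s ^ 2 = 1 := by
  have hmem : ∀ᵐ s ∂signLaw, s ∈ ({-1, 1} : Set ℝ) := ae_cond_mem (by measurability)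
  filter_upwards [hmem] with s hs
  exact sq_eq_one_iff.2 hs.symm

theorem memLp_id_signLaw : MemLp id 2 signLaw :=
  MemLp.of_bound aestronglyMeasurable_id 1 <| ae_signLaw_sq.mono fun s hs =>
    (sq_le_one_iff_abs_le_one s).1 hs.le

theorem integral_id_signLaw : ∫ s, s ∂signLaw = 0 := by
  rw [signLaw, uniformOn, ProbabilityTheory.cond, integral_smul_measure, insert_eq,
    Measure.restrict_union (by norm_num) (measurableSet_singleton _), Measure.restrict_singleton,
    Measure.restrict_singleton, Measure.count_singleton, Measure.count_singleton, one_smul,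
    one_smul, integral_add_measure (integrable_dirac (by simp)) (integrable_dirac (by simp))]
  simp

theorem integral_mul_signLaw {m : ℕ} (r s : Fin m) :
    ∫ a, a r * a s ∂(Measure.pi fun _ : Fin m => signLaw) = if r = s then 1 else 0 := by
  split_ifs with hrs
  · subst hrs
    have hsq : ∫ a, a r * a r ∂(Measure.pi fun _ : Fin m => signLaw) = ∫ s, s * s ∂signLaw :=
      integral_comp_eval (f := fun z => z * z) (by fun_prop)
    rw [hsq, integral_congr_ae (ae_signLaw_sq.mono fun s hs => (sq s).symm.trans hs)]
    simp
  · have hindep := (iIndepFun_pi (μ := fun _ : Fin m => signLaw) (X := fun _ z => z)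
      fun _ => aemeasurable_id).indepFun hrs
    rw [hindep.integral_fun_mul_eq_mul_integral (measurable_pi_apply r).aestronglyMeasurable
      (measurable_pi_apply s).aestronglyMeasurable, integral_eval (μ := fun _ : Fin m => signLaw),
      integral_id_signLaw, zero_mul]

theorem sum_mul_sq {m : ℕ} (a b : Fin m → ℝ) :
    (∑ r, a r * b r) ^ 2 = ∑ r, ∑ s, (b r * b s) * (a r * a s) := by
  rw [sq, Finset.sum_mul_sum]
  exact Finset.sum_congr rfl fun r _ => Finset.sum_congr rfl fun s _ => by ring

variable {Ω : Type*} [MeasurableSpace Ω] {μ : Measure Ω} {m : ℕ} {X : Fin m → Ω → ℝ}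

theorem integrable_rademacher_term [SFinite μ] (hX : ∀ r, MemLp (X r) 2 μ) (r s : Fin m) :
    Integrable (fun p : Ω × (Fin m → ℝ) => (X r p.1 * X s p.1) * (p.2 r * p.2 s))
      (μ.prod (Measure.pi fun _ => signLaw)) := by
  have hsign : ∀ r : Fin m, MemLp (fun a : Fin m → ℝ => a r) 2 (Measure.pi fun _ => signLaw) :=
    fun r => memLp_id_signLaw.comp_measurePreserving (measurePreserving_eval _ r)
  exact ((hX r).integrable_mul (hX s)).mul_prod ((hsign r).integrable_mul (hsign s))

theorem integrable_rademacher_sum_sq [SFinite μ] (hX : ∀ r, MemLp (X r) 2 μ) :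
    Integrable (fun p : Ω × (Fin m → ℝ) => (∑ r, p.2 r * X r p.1) ^ 2)
      (μ.prod (Measure.pi fun _ => signLaw)) := by
  simp only [sum_mul_sq]
  exact integrable_finsetSum _ fun r _ => integrable_finsetSum _ fun s _ =>
    integrable_rademacher_term hX r s

theorem integral_rademacher_sum_sq [SFinite μ] (hX : ∀ r, MemLp (X r) 2 μ) :
    ∫ p, (∑ r, p.2 r * X r p.1) ^ 2 ∂(μ.prod (Measure.pi fun _ : Fin m => signLaw)) =
      ∑ r, ∫ ω, X r ω ^ 2 ∂μ := by
  simp only [sum_mul_sq]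
  rw [integral_finsetSum _ fun r _ => integrable_finsetSum _ fun s _ =>
    integrable_rademacher_term hX r s]
  refine Finset.sum_congr rfl fun r _ => ?_
  rw [integral_finsetSum _ fun s _ => integrable_rademacher_term hX r s]
  simp only [fun s => integral_prod_mul (μ := μ) (ν := Measure.pi fun _ : Fin m => signLaw)
    (fun ω => X r ω * X s ω) fun a => a r * a s, integral_mul_signLaw, mul_ite, mul_one, mul_zero,
    Finset.sum_ite_eq, Finset.mem_univ, if_true, sq]

end Rademacher

section Initialization

variable {n d m : ℕ} {x : Fin n → EuclideanSpace ℝ (Fin d)}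

/-- The law of the first layer at initialization: `m` independent standard Gaussian weights. -/
noncomputable abbrev weightLaw (d m : ℕ) : Measure (Fin m → EuclideanSpace ℝ (Fin d)) :=
  Measure.pi fun _ => stdGaussian (EuclideanSpace ℝ (Fin d))

theorem initLaw_eq_prod (d m : ℕ) :
    initLaw d m = (weightLaw d m).prod (Measure.pi fun _ => signLaw) :=
  rfl

instance isProbabilityMeasure_initLaw : IsProbabilityMeasure (initLaw d m) := by
  rw [initLaw_eq_prod]
  infer_instance

theorem ae_initLaw_sq : ∀ᵐ p ∂(initLaw d m), ∀ r, p.2 r ^ 2 = 1 := by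
  rw [initLaw_eq_prod]
  refine Measure.quasiMeasurePreserving_snd.ae (p := fun a : Fin m → ℝ => ∀ r, a r ^ 2 = 1) ?_
  exact ae_all_iff.2 fun r =>
    (measurePreserving_eval (fun _ : Fin m => signLaw) r).quasiMeasurePreserving.ae ae_signLaw_sq

theorem integral_initLaw_fst (f : (Fin m → EuclideanSpace ℝ (Fin d)) → ℝ) :
    ∫ p, f p.1 ∂(initLaw d m) = ∫ w, f w ∂(weightLaw d m) := by
  rw [initLaw_eq_prod, integral_fun_fst, probReal_univ, one_smul]

theorem memLp_relu_inner (v : EuclideanSpace ℝ (Fin d)) :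
    MemLp (fun w => relu ⟪w, v⟫) 2 (stdGaussian (EuclideanSpace ℝ (Fin d))) :=
  (memLp_inner_stdGaussian v).mono (lipschitzWith_relu_inner v).continuous.aestronglyMeasurable
    (ae_of_all _ fun _ => sq_le_sq.1 (relu_sq_le _))

theorem memLp_relu_inner_apply (v : EuclideanSpace ℝ (Fin d)) (r : Fin m) :
    MemLp (fun w : Fin m → EuclideanSpace ℝ (Fin d) => relu ⟪w r, v⟫) 2 (weightLaw d m) :=
  (memLp_relu_inner v).comp_measurePreserving (measurePreserving_eval _ r)

theorem network_sq (w : Fin m → EuclideanSpace ℝ (Fin d)) (a : Fin m → ℝ)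
    (v : EuclideanSpace ℝ (Fin d)) :
    network w a v ^ 2 = 1 / m * (∑ r, a r * relu ⟪w r, v⟫) ^ 2 := by
  rw [network, mul_pow, div_pow, Real.sq_sqrt (Nat.cast_nonneg m), one_pow]

theorem integrable_network_sq (v : EuclideanSpace ℝ (Fin d)) :
    Integrable (fun p => network p.1 p.2 v ^ 2) (initLaw d m) := by
  simp only [network_sq]
  exact (integrable_rademacher_sum_sq fun r => memLp_relu_inner_apply v r).const_mul _

theorem integral_network_sq_le (v : EuclideanSpace ℝ (Fin d)) :
    ∫ p, network p.1 p.2 v ^ 2 ∂(initLaw d m) ≤ ‖v‖ ^ 2 := by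
  have hrelu : ∀ r : Fin m, ∫ w, relu ⟪w r, v⟫ ^ 2 ∂(weightLaw d m) ≤ ‖v‖ ^ 2 := fun r => by
    rw [integral_comp_eval (μ := fun _ => stdGaussian (EuclideanSpace ℝ (Fin d)))
      (f := fun w => relu ⟪w, v⟫ ^ 2) (memLp_relu_inner v).integrable_sq.aestronglyMeasurable,
      ← integral_inner_sq_stdGaussian]
    exact integral_mono (memLp_relu_inner v).integrable_sq
      (memLp_inner_stdGaussian v).integrable_sq fun w => relu_sq_le _
  calc ∫ p, network p.1 p.2 v ^ 2 ∂(initLaw d m)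
      = 1 / m * ∫ p, (∑ r, p.2 r * relu ⟪p.1 r, v⟫) ^ 2 ∂(initLaw d m) := by
        simp only [network_sq, integral_const_mul]
    _ = 1 / m * ∑ r, ∫ w, relu ⟪w r, v⟫ ^ 2 ∂(weightLaw d m) :=
        congrArg _ (integral_rademacher_sum_sq (memLp_relu_inner_apply v))
    _ ≤ 1 / m * ∑ _r : Fin m, ‖v‖ ^ 2 := by gcongr with r; exact hrelu r
    _ = m / m * ‖v‖ ^ 2 := by
        rw [Finset.sum_const, Finset.card_univ, Fintype.card_fin, nsmul_eq_mul]; ring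
    _ ≤ ‖v‖ ^ 2 := mul_le_of_le_one_left (sq_nonneg _) (div_self_le_one _)

theorem integrable_abs_activationGram_sub (x : Fin n → EuclideanSpace ℝ (Fin d)) (i j : Fin n) :
    Integrable (fun w : Fin m → EuclideanSpace ℝ (Fin d) =>
      |activationGram x (activation x w) i j - gramInfinity x i j|) (weightLaw d m) := by
  have hcoact : Integrable (coactivation x i j) (stdGaussian (EuclideanSpace ℝ (Fin d))) :=
    .of_bound (measurable_coactivation x i j).aestronglyMeasurable _
      (ae_of_all _ fun w => norm_indicator_le_norm_self _ w)
  simp only [activationGram_activation]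
  exact (((integrable_finsetSum _ fun r _ => integrable_comp_eval hcoact).const_mul _).sub
    (integrable_const _)).abs

theorem integrable_indicator_boundaryStrip (R : ℝ) (v : EuclideanSpace ℝ (Fin d)) (r : Fin m) :
    Integrable (fun w : Fin m → EuclideanSpace ℝ (Fin d) =>
      (boundaryStrip R v).indicator (1 : EuclideanSpace ℝ (Fin d) → ℝ) (w r)) (weightLaw d m) :=
  integrable_comp_eval (μ := fun _ => stdGaussian (EuclideanSpace ℝ (Fin d)))
    (f := (boundaryStrip R v).indicator (1 : EuclideanSpace ℝ (Fin d) → ℝ))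
    ((integrable_const 1).indicator (measurableSet_boundaryStrip R v))

theorem gramFluctuation_nonneg (x : Fin n → EuclideanSpace ℝ (Fin d)) (R : ℝ)
    (w : Fin m → EuclideanSpace ℝ (Fin d)) : 0 ≤ gramFluctuation x R w :=
  add_nonneg (Finset.sum_nonneg fun _ _ => Finset.sum_nonneg fun _ _ => abs_nonneg _) <|
    mul_nonneg (by positivity) <| Finset.sum_nonneg fun _ _ => Finset.sum_nonneg fun _ _ =>
      indicator_nonneg (fun _ _ => zero_le_one) _

theorem integrable_gramFluctuation (x : Fin n → EuclideanSpace ℝ (Fin d)) (R : ℝ) :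
    Integrable (fun w : Fin m → EuclideanSpace ℝ (Fin d) => gramFluctuation x R w)
      (weightLaw d m) :=
  (integrable_finsetSum _ fun i _ => integrable_finsetSum _ fun j _ =>
    integrable_abs_activationGram_sub x i j).add <|
    (integrable_finsetSum _ fun i _ => integrable_finsetSum _ fun r _ =>
      integrable_indicator_boundaryStrip R (x i) r).const_mul _

theorem integral_abs_activationGram_sub_le (hm : 0 < m) (hx : ∀ i, ‖x i‖ ≤ 1) (i j : Fin n) :
    ∫ w, |activationGram x (activation x w) i j - gramInfinity x i j|
      ∂(weightLaw d m) ≤ 1 / √m := by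
  simp only [activationGram_activation, gramInfinity_apply]
  exact integral_abs_sampleMean_sub_le hm (measurable_coactivation x i j)
    (norm_coactivation_le hx i j)

theorem integral_indicator_boundaryStrip_le {v : EuclideanSpace ℝ (Fin d)} (hv : v ≠ 0) {R : ℝ}
    (hR : 0 ≤ R) (r : Fin m) :
    ∫ w, (boundaryStrip R v).indicator (1 : EuclideanSpace ℝ (Fin d) → ℝ) (w r)
      ∂(weightLaw d m) ≤ R := by
  have hmeas := measurableSet_boundaryStrip R v
  rw [integral_comp_eval (μ := fun _ => stdGaussian (EuclideanSpace ℝ (Fin d)))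
    (f := (boundaryStrip R v).indicator (1 : EuclideanSpace ℝ (Fin d) → ℝ))
    (measurable_one.indicator hmeas).aestronglyMeasurable, integral_indicator_one hmeas]
  exact stdGaussian_real_boundaryStrip_le hv hR

theorem integral_gramFluctuation_le (hm : 0 < m) (hx : ∀ i, ‖x i‖ ≤ 1) (hx₀ : ∀ i, x i ≠ 0)
    {R : ℝ} (hR : 0 ≤ R) :
    ∫ w, gramFluctuation x R w ∂(weightLaw d m) ≤ n ^ 2 / √m + 2 * n ^ 2 * R := by
  have hgram := fun i j => integrable_abs_activationGram_sub (m := m) x i j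
  have hstrip := fun i (r : Fin m) => integrable_indicator_boundaryStrip R (x i) r
  simp only [gramFluctuation]
  rw [integral_add (integrable_finsetSum _ fun i _ => integrable_finsetSum _ fun j _ => hgram i j)
    ((integrable_finsetSum _ fun i _ => integrable_finsetSum _ fun r _ => hstrip i r).const_mul _),
    integral_const_mul,
    integral_finsetSum _ fun i _ => integrable_finsetSum _ fun j _ => hgram i j,
    integral_finsetSum _ fun i _ => integrable_finsetSum _ fun r _ => hstrip i r]
  simp only [integral_finsetSum _ fun j _ => hgram _ j, integral_finsetSum _ fun r _ => hstrip _ r]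
  calc _ ≤ ∑ _i : Fin n, ∑ _j : Fin n, 1 / √m + 2 * n / m * ∑ _i : Fin n, ∑ _r : Fin m, R := by
        gcongr with i _ j _ i _ r
        · exact integral_abs_activationGram_sub_le hm hx i j
        · exact integral_indicator_boundaryStrip_le (hx₀ i) hR r
    _ = n ^ 2 / √m + 2 * n ^ 2 * R := by
        simp only [Finset.sum_const, Finset.card_univ, Fintype.card_fin, nsmul_eq_mul]
        field_simp

end Initialization

section GoodInitialization

variable {n d m : ℕ} {x : Fin n → EuclideanSpace ℝ (Fin d)} {y : EuclideanSpace ℝ (Fin n)}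
  {C δ : ℝ}

/-- The distance from initialization within which the Gram matrix stays positive definite, when the
failure probability is `δ`. -/
noncomputable def stabilityRadius (x : Fin n → EuclideanSpace ℝ (Fin d)) (δ : ℝ) : ℝ :=
  leastEigenvalue (gramInfinity x) * δ / (16 * n ^ 2)

/-- The event of probability at least `1 - δ` on which the gradient flow converges: the Gram matrix
is positive definite near the initial weights, the initial predictions are bounded, and the output
weights are signs (which fails on a null set only). -/
def goodInit (x : Fin n → EuclideanSpace ℝ (Fin d)) (δ : ℝ) :
    Set ((Fin m → EuclideanSpace ℝ (Fin d)) × (Fin m → ℝ)) :=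
  {p | gramFluctuation x (stabilityRadius x δ) p.1 < leastEigenvalue (gramInfinity x) / 2 ∧
    ∑ i, network p.1 p.2 (x i) ^ 2 < 2 * n / δ ∧ ∀ r, p.2 r ^ 2 = 1}

theorem initLaw_gramFluctuation_ge_le (hlam : 0 < leastEigenvalue (gramInfinity x))
    (hx : ∀ i, ‖x i‖ ≤ 1) (hδ : 0 ≤ δ)
    (hm : 64 * n ^ 4 ≤ leastEigenvalue (gramInfinity x) ^ 2 * δ ^ 2 * m) :
    initLaw d m {p | leastEigenvalue (gramInfinity x) / 2 ≤
      gramFluctuation x (stabilityRadius x δ) p.1} ≤ ENNReal.ofReal (δ / 2) := by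
  have hn : (0 : ℝ) < n := Nat.cast_pos.2 (pos_of_leastEigenvalue_pos hlam)
  have hx₀ : ∀ i, x i ≠ 0 := fun i h => by
    simpa [h] using hlam.trans_le (leastEigenvalue_gramInfinity_le x i)
  have hm₀ : 0 < m := Nat.pos_of_ne_zero fun h => by
    subst h
    simp only [Nat.cast_zero, mul_zero] at hm
    exact absurd hm (not_le.2 (by positivity))
  rw [stabilityRadius]
  set lam := leastEigenvalue (gramInfinity x)
  have hsampling : n ^ 2 / √m ≤ lam * δ / 8 := by
    have hsqrt : 8 * (n : ℝ) ^ 2 ≤ lam * δ * √m := by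
      refine le_of_sq_le_sq ?_ (by positivity)
      rw [mul_pow (lam * δ), Real.sq_sqrt (Nat.cast_nonneg m)]
      linarith
    rw [div_le_iff₀ (by positivity)]
    linarith
  refine measure_ge_le_of_integral_le (fun p => gramFluctuation_nonneg x _ p.1)
    ((integrable_gramFluctuation x _).comp_fst _) (half_pos hlam) ?_
  rw [integral_initLaw_fst (gramFluctuation x _)]
  calc _ ≤ n ^ 2 / √m + 2 * n ^ 2 * (lam * δ / (16 * n ^ 2)) :=
        integral_gramFluctuation_le hm₀ hx hx₀ (by positivity)
    _ = n ^ 2 / √m + lam * δ / 8 := by field_simp; ring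
    _ ≤ lam / 2 * (δ / 2) := by linarith

theorem initLaw_sum_network_sq_ge_le (hn : 0 < n) (hx : ∀ i, ‖x i‖ ≤ 1) (hδ : 0 < δ) :
    initLaw d m {p | 2 * n / δ ≤ ∑ i, network p.1 p.2 (x i) ^ 2} ≤ ENNReal.ofReal (δ / 2) := by
  refine measure_ge_le_of_integral_le (fun p => Finset.sum_nonneg fun _ _ => sq_nonneg _)
    (integrable_finsetSum _ fun i _ => integrable_network_sq (x i)) (by positivity) ?_
  rw [integral_finsetSum _ fun i _ => integrable_network_sq (x i)]
  calc _ ≤ ∑ _i : Fin n, (1 : ℝ) := Finset.sum_le_sum fun i _ =>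
        (integral_network_sq_le (x i)).trans (pow_le_one₀ (norm_nonneg _) (hx i))
    _ = 2 * n / δ * (δ / 2) := by simp; field_simp

theorem initLaw_compl_goodInit_le (hlam : 0 < leastEigenvalue (gramInfinity x))
    (hx : ∀ i, ‖x i‖ ≤ 1) (hδ : 0 < δ)
    (hm : 64 * n ^ 4 ≤ leastEigenvalue (gramInfinity x) ^ 2 * δ ^ 2 * m) :
    initLaw d m (goodInit x δ)ᶜ ≤ ENNReal.ofReal δ := by
  have hsign : initLaw d m {p | ∀ r, p.2 r ^ 2 = 1}ᶜ = 0 := ae_initLaw_sq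
  rw [goodInit, ofPred_and, ofPred_and, compl_inter, compl_inter]
  calc _ ≤ _ := (measure_union_le _ _).trans (add_le_add_right (measure_union_le _ _) _)
    _ ≤ ENNReal.ofReal (δ / 2) + (ENNReal.ofReal (δ / 2) + 0) := by
        simp only [compl_ofPred, not_lt]
        gcongr
        · exact initLaw_gramFluctuation_ge_le hlam hx hδ.le hm
        · exact initLaw_sum_network_sq_ge_le (pos_of_leastEigenvalue_pos hlam) hx hδ
        · exact hsign.le
    _ = ENNReal.ofReal δ := by
        rw [add_zero, ← ENNReal.ofReal_add (by positivity) (by positivity), add_halves]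

theorem norm_prediction_sub_sq_le_of_abs_le (hy : ∀ i, |y i| ≤ C) (a : Fin m → ℝ)
    (w : Fin m → EuclideanSpace ℝ (Fin d)) :
    ‖prediction x a w - y‖ ^ 2 ≤ 2 * ∑ i, network w a (x i) ^ 2 + 2 * n * C ^ 2 := by
  rw [EuclideanSpace.real_norm_sq_eq]
  calc ∑ i, (network w a (x i) - y i) ^ 2 ≤ ∑ i, (2 * network w a (x i) ^ 2 + 2 * C ^ 2) := by
        gcongr with i
        nlinarith [sq_nonneg (network w a (x i) + y i), sq_le_sq' (abs_le.1 (hy i)).1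
          (abs_le.1 (hy i)).2]
    _ = 2 * ∑ i, network w a (x i) ^ 2 + 2 * n * C ^ 2 := by
        rw [Finset.sum_add_distrib, ← Finset.mul_sum, Finset.sum_const, Finset.card_univ,
          Fintype.card_fin, nsmul_eq_mul]
        ring

theorem displacement_lt_of_width {N M lam u : ℝ} (hN : 0 < N) (hM : 0 < M) (hlam : 0 < lam)
    (hδ : 0 < δ) (hu : u ^ 2 ≤ N * (4 + 2 * C ^ 2) / δ)
    (hwidth : 2048 * (3 + C ^ 2) * N ^ 6 ≤ M * (lam ^ 4 * δ ^ 3)) :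
    √(N / M) * u / (lam / 2) < lam * δ / (16 * N ^ 2) := by
  refine lt_of_pow_lt_pow_left₀ 2 (by positivity) ?_
  calc (√(N / M) * u / (lam / 2)) ^ 2 = N / M * u ^ 2 * (4 / lam ^ 2) := by
        rw [div_pow, mul_pow, Real.sq_sqrt (by positivity)]; field_simp; norm_num
    _ ≤ N / M * (N * (4 + 2 * C ^ 2) / δ) * (4 / lam ^ 2) := by gcongr
    _ = 8 * N ^ 2 * (2 + C ^ 2) / (M * δ * lam ^ 2) := by field_simp; ring
    _ < lam ^ 2 * δ ^ 2 / (256 * N ^ 4) := by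
        rw [div_lt_div_iff₀ (by positivity) (by positivity)]
        nlinarith [pow_pos hN 6]
    _ = (lam * δ / (16 * N ^ 2)) ^ 2 := by ring

theorem norm_prediction_sub_sq_le_of_mem_goodInit
    {p : (Fin m → EuclideanSpace ℝ (Fin d)) × (Fin m → ℝ)} (hp : p ∈ goodInit x δ)
    (hy : ∀ i, |y i| ≤ C) (hδ : 0 < δ) (hδ₁ : δ ≤ 1) :
    ‖prediction x p.2 p.1 - y‖ ^ 2 ≤ n * (4 + 2 * C ^ 2) / δ := by
  have hC : 2 * n * C ^ 2 ≤ 2 * n * C ^ 2 / δ := le_div_self (by positivity) hδ hδ₁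
  calc _ ≤ 2 * (2 * n / δ) + 2 * n * C ^ 2 / δ :=
        (norm_prediction_sub_sq_le_of_abs_le hy p.2 p.1).trans
          (add_le_add (mul_le_mul_of_nonneg_left hp.2.1.le zero_le_two) hC)
    _ = n * (4 + 2 * C ^ 2) / δ := by ring

theorem gramLowerBound_of_mem_goodInit
    {p : (Fin m → EuclideanSpace ℝ (Fin d)) × (Fin m → ℝ)} (hp : p ∈ goodInit x δ)
    (hx : ∀ i, ‖x i‖ ≤ 1) {w : Fin m → EuclideanSpace ℝ (Fin d)}
    (hw : ∀ r, ‖w r - p.1 r‖ ≤ stabilityRadius x δ) :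
    GramLowerBound x (leastEigenvalue (gramInfinity x) / 2) w :=
  (gramLowerBound_sub_gramFluctuation hx hw).mono (by linarith [hp.1])

theorem sampleSize_le_of_width (hlam : 0 < leastEigenvalue (gramInfinity x))
    (hx : ∀ i, ‖x i‖ ≤ 1) (hδ : 0 < δ) (hδ₁ : δ ≤ 1)
    (hwidth : 2048 * (3 + C ^ 2) * n ^ 6 ≤
      m * (leastEigenvalue (gramInfinity x) ^ 4 * δ ^ 3)) :
    64 * n ^ 4 ≤ leastEigenvalue (gramInfinity x) ^ 2 * δ ^ 2 * m := by
  have hn := pos_of_leastEigenvalue_pos hlam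
  have hn₁ : (1 : ℝ) ≤ n := by exact_mod_cast hn
  have hlam₁ : leastEigenvalue (gramInfinity x) ≤ 1 :=
    (leastEigenvalue_gramInfinity_le x ⟨0, hn⟩).trans (pow_le_one₀ (norm_nonneg _) (hx _))
  calc 64 * (n : ℝ) ^ 4 ≤ 2048 * (3 + C ^ 2) * n ^ 6 :=
        mul_le_mul (by nlinarith [sq_nonneg C]) (pow_le_pow_right₀ hn₁ (by norm_num))
          (by positivity) (by positivity)
    _ ≤ m * (leastEigenvalue (gramInfinity x) ^ 4 * δ ^ 3) := hwidth
    _ ≤ m * (leastEigenvalue (gramInfinity x) ^ 2 * δ ^ 2) := by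
        gcongr ?_ * (?_ * ?_)
        · exact pow_le_pow_of_le_one hlam.le hlam₁ (by norm_num)
        · exact pow_le_pow_of_le_one hδ.le hδ₁ (by norm_num)
    _ = leastEigenvalue (gramInfinity x) ^ 2 * δ ^ 2 * m := mul_comm _ _

end GoodInitialization

end TwoLayerReLU

open TwoLayerReLU in
theorem theorem3p2_general {n d m : ℕ} {x : Fin n → EuclideanSpace ℝ (Fin d)}
    {y : EuclideanSpace ℝ (Fin n)} {C δ : ℝ} (hlam : 0 < leastEigenvalue (gramInfinity x))
    (hx : ∀ i, ‖x i‖ ≤ 1) (hy : ∀ i, |y i| ≤ C) (hδ : 0 < δ)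
    (hm : 2048 * (3 + C ^ 2) * ((n : ℝ) ^ 6 /
      (leastEigenvalue (gramInfinity x) ^ 4 * δ ^ 3)) ≤ (m : ℝ)) :
    ∃ E : Set ((Fin m → EuclideanSpace ℝ (Fin d)) × (Fin m → ℝ)),
      MeasurableSet E ∧ ENNReal.ofReal (1 - δ) ≤ initLaw d m E ∧
      ∀ p ∈ E, ∀ W : ℝ → Fin m → EuclideanSpace ℝ (Fin d),
        IsGradientFlow x y p.2 W → W 0 = p.1 → ∀ t : ℝ, 0 ≤ t →
          ‖prediction x p.2 (W t) - y‖ ^ 2 ≤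
            Real.exp (-leastEigenvalue (gramInfinity x) * t) *
              ‖prediction x p.2 (W 0) - y‖ ^ 2 := by
  rcases le_or_gt 1 δ with hδ₁ | hδ₁
  · exact ⟨∅, .empty, by simp [hδ₁], fun p hp => absurd hp (notMem_empty p)⟩
  have hn : (0 : ℝ) < n := Nat.cast_pos.2 (pos_of_leastEigenvalue_pos hlam)
  have hm₀ : (0 : ℝ) < m := lt_of_lt_of_le (by positivity) hm
  rw [← mul_div_assoc, div_le_iff₀ (by positivity)] at hm
  obtain ⟨E, hE_good, hE_meas, hE⟩ := exists_measurableSet_subset_of_measure_compl_le hδ.le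
    (initLaw_compl_goodInit_le hlam hx hδ (sampleSize_le_of_width hlam hx hδ hδ₁.le hm))
  refine ⟨E, hE_meas, hE, fun p hp W hW hW₀ t ht => ?_⟩
  have hgood := hE_good hp
  have hmove := displacement_lt_of_width hn hm₀ hlam hδ
    (norm_prediction_sub_sq_le_of_mem_goodInit hgood hy hδ hδ₁.le) hm
  rw [← hW₀] at hmove
  have hdecay := hW.norm_prediction_sub_sq_le_of_gramLowerBound hx hgood.2.2 (half_pos hlam)
    (fun w hw => gramLowerBound_of_mem_goodInit hgood hx fun r => hW₀ ▸ (hw r).le) hmove ht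
  rwa [mul_div_cancel₀ _ two_ne_zero] at hdecay

theorem theorem3p2 (C : ℝ) :
    ∃ K : ℝ, 0 < K ∧
      ∀ (n d m : ℕ) (x : Fin n → EuclideanSpace ℝ (Fin d)) (y : EuclideanSpace ℝ (Fin n)) (δ : ℝ),
        0 < TwoLayerReLU.leastEigenvalue (TwoLayerReLU.gramInfinity x) →
        (∀ i, ‖x i‖ = 1) →
        (∀ i, |y i| ≤ C) →
        0 < δ →
        K * ((n : ℝ) ^ 6 /
          (TwoLayerReLU.leastEigenvalue (TwoLayerReLU.gramInfinity x) ^ 4 * δ ^ 3)) ≤ (m : ℝ) →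
        ∃ E : Set ((Fin m → EuclideanSpace ℝ (Fin d)) × (Fin m → ℝ)),
          MeasurableSet E ∧
          ENNReal.ofReal (1 - δ) ≤ TwoLayerReLU.initLaw d m E ∧
          ∀ p ∈ E, ∀ W : ℝ → Fin m → EuclideanSpace ℝ (Fin d),
            TwoLayerReLU.IsGradientFlow x y p.2 W → W 0 = p.1 →
            ∀ t : ℝ, 0 ≤ t →
              ‖TwoLayerReLU.prediction x p.2 (W t) - y‖ ^ 2 ≤
                Real.exp (-TwoLayerReLU.leastEigenvalue (TwoLayerReLU.gramInfinity x) * t) *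
                  ‖TwoLayerReLU.prediction x p.2 (W 0) - y‖ ^ 2 :=
  ⟨2048 * (3 + C ^ 2), by positivity, fun _ _ _ _ _ _ hlam hx hy hδ hm =>
    theorem3p2_general hlam (fun i => (hx i).le) hy hδ hm⟩
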